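/- **Setting.** For $n\ge 3$ the input is a uniformly random permutation $(a_1,\dots,a_n)$ of $\{1,\dots,n\}$. The pivots are $p=\min(a_1,a_n)$ and $q=\max(a_1,a_n)$. An element $a_i$ with $2\le i\le n-1$ is *small* if $a_i<p$, *medium* if $p<a_i<q$, and *large* if $a_i>q$; there are $s=p-1$ small and $\ell=n-q$ large elements. A *classification decision tree* $T$ for inputs of size $n$ is a rooted tree with $n-2$ levels of inner nodes and one leaf level. Each inner node $v$ has an index $i(v)\in\{2,\dots,n-1\}$, a label $l(v)\in\{\mathrm p,\mathrm q\}$, and three outgoing edges, for the outcomes small, medium and large; on each root-to-leaf path every index occurs exactly once. An input follows a path from the root: at node $v$, the element $a_{i(v)}$ is compared first with the smaller pivot $p$ if $l(v)=\mathrm p$, and first with the larger pivot $q$ if $l(v)=\mathrm q$; it is then compared with the other pivot if its class is not yet known, and the edge of its class is followed. (So one comparison is made if $l(v)=\mathrm p$ and the element is small, or $l(v)=\mathrm q$ and it is large; otherwise two are made.) Let $P_n^T$ be the total number of key comparisons made on the input: one comparison of $a_1$ with $a_n$, plus all comparisons at the nodes of the path. Let $F^T_{\mathrm p}$ and $F^T_{\mathrm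 q}$ be the numbers of elements that are compared first with the smaller and with the larger pivot, respectively, and put $f^{\mathrm p}_{s,\ell}=\mathrm E(F^T_{\mathrm p}\mid s,\ell)$ and $f^{\mathrm q}_{s,\ell}=\mathrm E(F^T_{\mathrm q}\mid s,\ell)$, the conditional expectations given that there are exactly $s$ small and $\ell$ large elements. **Lemma.** For every classification decision tree $T$ for inputs of size $n\ge 3$, $$\mathrm E(P_n^T)=\frac43 n+\frac{1}{\binom n2 (n-2)}\sum_{\substack{s,\ell\ge 0\\ s+\ell\le n-2}}\bigl(f^{\mathrm q}_{s,\ell}\cdot s+f^{\mathrm p}_{s,\ell}\cdot \ell\bigr)+o(n),$$ where the error term is uniform in $T$: there is a function $g(n)=o(n)$, not depending on $T$, such that for all $n\ge3$ and all such $T$ the two sides without the error term differ by at most $g(n)$ in absolute value. -/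

import Mathlib

open scoped BigOperators Asymptotics

namespace DualPivot

/-- Which of the two pivots an element is compared with first:
`p` is the smaller pivot, `q` the larger one. -/
inductive Pivot where
  | p
  | q
  deriving DecidableEq

/-- The three possible outcomes of classifying an element (the edge labels `σ`, `μ`, `λ`). -/
inductive Cls where
  | small
  | medium
  | large
  deriving DecidableEq

/-- Finite three-way trees whose inner nodes `v` carry an index `i(v)` and a label `l(v)`.
The child `child c` is the one at the end of the edge labelled `c`. -/
inductive ClassTree where
  | leaf : ClassTree
  | node (i : ℕ) (l : Pivot) (child : Cls → ClassTree) : ClassTree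

/-- On every path from the root to a leaf, every index of `A` occurs exactly once, and no other
index occurs. -/
def ClassTree.Exhausts : ClassTree → Finset ℕ → Prop
  | .leaf, A => A = ∅
  | .node i _ child, A => i ∈ A ∧ ∀ c, (child c).Exhausts (A.erase i)

/-- A decision tree for inputs `(a₁, …, aₙ)` whose pivots are `a₁` and `aₙ`: on each path, each of
the indices `2, …, n - 1` occurs exactly once (so all leaves are on level `n - 2`). -/
structure DecisionTree (n : ℕ) where
  tree : ClassTree
  exhausts : tree.Exhausts (Finset.Icc 2 (n - 1))

/-- The class of the key `x` with respect to pivots `p < q`, where `x ≠ p` and `x ≠ q`. -/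
def classify (p q x : ℕ) : Cls :=
  if x < p then .small else if x < q then .medium else .large

/-- The number of key comparisons used to classify the key `x` when it is first compared with the
pivot given by the label. The other pivot is consulted only if the first comparison leaves the
class open. -/
def comparisons (p q : ℕ) : Pivot → ℕ → ℕ
  | .p, x => if x < p then 1 else 2
  | .q, x => if q < x then 1 else 2

/-- The number of key comparisons made along the path that the input `a` takes in the tree. -/
def ClassTree.pathComparisons (p q : ℕ) (a : ℕ → ℕ) : ClassTree → ℕ
  | .leaf => 0
  | .node i l child =>
      comparisons p q l (a i) + (child (classify p q (a i))).pathComparisons p q a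

/-- The number of nodes labelled `r` on the path that the input `a` takes in the tree. -/
def ClassTree.pathCount (p q : ℕ) (a : ℕ → ℕ) (r : Pivot) : ClassTree → ℕ
  | .leaf => 0
  | .node i l child =>
      (if l = r then 1 else 0) + (child (classify p q (a i))).pathCount p q a r

/-- Inputs: permutations of `{1, …, n}`, coded as permutations of `Fin n = {0, …, n - 1}`. -/
abbrev Input (n : ℕ) := Equiv.Perm (Fin n)

/-- The element `aᵢ ∈ {1, …, n}` of the input sequence, for `1 ≤ i ≤ n`
(the value for other `i` is never used). -/
def Input.elt {n : ℕ} (π : Input n) (i : ℕ) : ℕ :=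
  if h : i - 1 < n then (π ⟨i - 1, h⟩ : ℕ) + 1 else 0

/-- The smaller pivot `p = min(a₁, aₙ)`. -/
def Input.smallerPivot {n : ℕ} (π : Input n) : ℕ := min (π.elt 1) (π.elt n)

/-- The larger pivot `q = max(a₁, aₙ)`. -/
def Input.largerPivot {n : ℕ} (π : Input n) : ℕ := max (π.elt 1) (π.elt n)

/-- The number `s = p - 1` of small elements. -/
def Input.numSmall {n : ℕ} (π : Input n) : ℕ := π.smallerPivot - 1

/-- The number `ℓ = n - q` of large elements. -/
def Input.numLarge {n : ℕ} (π : Input n) : ℕ := n - π.largerPivot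

namespace DecisionTree

variable {n : ℕ} (T : DecisionTree n)

/-- The number of key comparisons that `T` makes to classify the input `π`: one comparison
between `a₁` and `aₙ`, followed by the comparisons along the path of `π`. -/
def cost (π : Input n) : ℕ :=
  1 + T.tree.pathComparisons π.smallerPivot π.largerPivot π.elt

/-- The number of elements of the input `π` that `T` compares first with the smaller pivot
(`r = p`) or with the larger pivot (`r = q`). -/
def firstCount (r : Pivot) (π : Input n) : ℕ :=
  T.tree.pathCount π.smallerPivot π.largerPivot π.elt r

/-- The average of `cost` over all `n!` inputs. -/
noncomputable def expectedCost : ℝ := 𝔼 π : Input n, (T.cost π : ℝ)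

/-- The expectation of `firstCount r`, conditioned on there being exactly `s` small and `l` large
elements, i.e. its average over all inputs with these numbers of small and large elements. -/
noncomputable def condFirstCount (r : Pivot) (s l : ℕ) : ℝ :=
  𝔼 π : Input n with π.numSmall = s ∧ π.numLarge = l, (T.firstCount r π : ℝ)

end DecisionTree

end DualPivot

/-!
Fix the numbers `s` and `l` of small and large elements. Apart from the comparison of the pivots,
an input costs one comparison per element, one more per medium element, and one more per element
that is first compared with the wrong pivot (small elements at `q`, large elements at `p`); see
`ClassTree.pathComparisons_eq`. All admissible pairs `(s, l)` are equally likely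
(`card_fiber_mul_choose`), so the medium elements contribute `(n - 2) / 3` on average, which
together with the first comparisons gives `4 / 3 * n - 5 / 3`.

It remains to show that, on average, the number of large elements first compared with `p` is close
to `l / (n - 2)` times the number of all elements first compared with `p`, and likewise for small
elements and `q`. Inputs with given `s` and `l` are exchangeable under transpositions of the
non-pivot positions, so whichever position the tree inspects next, it holds a large element with
probability `x / k`, where `x` of the `k` uninspected elements are large. However the tree chooses
positions and labels, the discrepancy is therefore at most the expected sum of the deviations
`|x / k - ρ|` with `ρ = l / (n - 2)`. The density `x / k` is a martingale whose steps from `k` to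
`k - 1` have variance at most `1 / (4 * (k - 1) ^ 2)`; bounding a deviation `d` by
`ε / 2 * d ^ 2 + 1 / (2 * ε)` yields a potential function (`potential`, `abs_add_potential_le`)
that controls this sum by induction on the tree (`ClassTree.abs_sum_hits_sub_le`). With
`ε = n ^ (1 / 4)` the error is at most `n ^ (3 / 4)`, independently of the tree.
-/

namespace DualPivot

open Finset

/-! ### Exchangeable families and adaptive sampling -/

/-- The number of nodes labelled `r` at which the path of the class assignment `κ` leaves along
the edge `c`. -/
def ClassTree.hits (c : Cls) (r : Pivot) (κ : ℕ → Cls) : ClassTree → ℕ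
  | .leaf => 0
  | .node i l child => (if l = r ∧ κ i = c then 1 else 0) + (child (κ i)).hits c r κ

/-- The number of nodes labelled `r` on the path of the class assignment `κ`. -/
def ClassTree.visits (r : Pivot) (κ : ℕ → Cls) : ClassTree → ℕ
  | .leaf => 0
  | .node i l child => (if l = r then 1 else 0) + (child (κ i)).visits r κ

/-- A finite family `S` of class assignments is exchangeable on the index set `A` if every
transposition of two indices of `A` is induced by an injection of `S` into itself. -/
def Exchangeable {Ω : Type*} (κ : Ω → ℕ → Cls) (A : Finset ℕ) (S : Finset Ω) : Prop :=
  ∀ i ∈ A, ∀ j ∈ A, ∃ σ : Ω → Ω, (∀ ω ∈ S, σ ω ∈ S) ∧ Set.InjOn σ S ∧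
    ∀ ω ∈ S, ∀ k, κ (σ ω) k = κ ω (Equiv.swap i j k)

theorem Exchangeable.filter_erase {Ω : Type*} {κ : Ω → ℕ → Cls} {A : Finset ℕ} {S : Finset Ω}
    (h : Exchangeable κ A S) (i : ℕ) (c : Cls) :
    Exchangeable κ (A.erase i) {ω ∈ S | κ ω i = c} := by
  intro j hj k hk
  rw [mem_erase] at hj hk
  obtain ⟨σ, h1, h2, h3⟩ := h j hj.2 k hk.2
  refine ⟨σ, fun ω hω => ?_, fun x hx y hy hxy => ?_, fun ω hω => h3 ω (mem_filter.1 hω).1⟩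
  · rw [mem_filter] at hω ⊢
    refine ⟨h1 ω hω.1, ?_⟩
    rw [h3 ω hω.1, Equiv.swap_apply_of_ne_of_ne hj.1.symm hk.1.symm, hω.2]
  · exact h2 (mem_filter.1 hx).1 (mem_filter.1 hy).1 hxy

/-- If every member of an exchangeable family has exactly `m` indices of class `c` in `A`, then a
given index of `A` has class `c` in the fraction `m / #A` of the family. -/
theorem Exchangeable.card_mul_card_filter {Ω : Type*} {κ : Ω → ℕ → Cls} {A : Finset ℕ}
    {S : Finset Ω} (h : Exchangeable κ A S) {c : Cls} {m : ℝ}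
    (hm : ∀ ω ∈ S, (#{j ∈ A | κ ω j = c} : ℝ) = m) {i : ℕ} (hi : i ∈ A) :
    (#A : ℝ) * #{ω ∈ S | κ ω i = c} = m * #S := by
  have hle : ∀ j ∈ A, ∀ k ∈ A, #{ω ∈ S | κ ω j = c} ≤ #{ω ∈ S | κ ω k = c} := by
    intro j hj k hk
    obtain ⟨σ, h1, h2, h3⟩ := h j hj k hk
    refine card_le_card_of_injOn σ (fun ω hω => ?_)
      (h2.mono fun ω hω => (mem_filter.1 hω).1)
    have hω' := mem_filter.1 hω
    exact mem_filter.2 ⟨h1 ω hω'.1, by rw [h3 ω hω'.1, Equiv.swap_apply_right, hω'.2]⟩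
  have hcount : ∑ j ∈ A, #{ω ∈ S | κ ω j = c} = ∑ ω ∈ S, #{j ∈ A | κ ω j = c} := by
    simp only [card_filter]
    exact sum_comm
  have hconst : ∑ j ∈ A, #{ω ∈ S | κ ω j = c} = #A * #{ω ∈ S | κ ω i = c} := by
    rw [sum_congr rfl fun j hj => le_antisymm (hle j hj i hi) (hle i hi j hj), sum_const,
      smul_eq_mul]
  have : ((∑ ω ∈ S, #{j ∈ A | κ ω j = c} : ℕ) : ℝ) = m * #S := by
    push_cast
    rw [sum_congr rfl hm, sum_const, nsmul_eq_mul, mul_comm]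
  rw [← this, ← hcount, hconst]
  push_cast
  ring

/-- The potential that controls the discrepancy of a subtree with `k` remaining indices, `x` of
which belong to the class in question, relative to the reference density `ρ`. The term `√k` pays for
the variance of the density in later steps, and `ε` is the parameter of the bound
`|d| ≤ ε / 2 * d ^ 2 + 1 / (2 * ε)` for a deviation `d`. -/
noncomputable def potential (ε ρ k x : ℝ) : ℝ :=
  ε / 2 * (k * (x / k - ρ) ^ 2 + √k) + k / (2 * ε)

theorem sqrt_add_inv_le {k : ℝ} (hk : 1 ≤ k) : √k + 1 / (4 * k) ≤ √(k + 1) := by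
  apply Real.le_sqrt_of_sq_le
  obtain ⟨y, h1, rfl⟩ : ∃ y : ℝ, 1 ≤ y ∧ k = y ^ 2 :=
    ⟨√k, Real.one_le_sqrt.2 hk, (Real.sq_sqrt (zero_le_one.trans hk)).symm⟩
  have hy : 0 < y := by linarith
  rw [Real.sqrt_sq hy.le]
  have e : (y + 1 / (4 * y ^ 2)) ^ 2 = y ^ 2 + 1 / (2 * y) + 1 / (16 * y ^ 4) := by
    field_simp; ring
  have b1 : 1 / (2 * y) ≤ 1 / 2 := one_div_le_one_div_of_le (by norm_num) (by linarith)
  have b2 : 1 / (16 * y ^ 4) ≤ 1 / 16 :=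
    one_div_le_one_div_of_le (by norm_num) (by nlinarith [one_le_pow₀ (n := 4) h1])
  linarith

/-- One step of sampling without replacement decreases the expected potential at least by the
current deviation of the density from `ρ`. -/
theorem abs_add_potential_le {ε : ℝ} (hε : 0 < ε) (ρ : ℝ) (k : ℕ) {x : ℝ} :
    |x / (k + 1 : ℝ) - ρ| + (x / (k + 1 : ℝ) * potential ε ρ k (x - 1) +
      (1 - x / (k + 1 : ℝ)) * potential ε ρ k x) ≤ potential ε ρ (k + 1) x := by
  have hk1 : (0 : ℝ) < k + 1 := by positivity
  obtain ⟨z, rfl⟩ : ∃ z, x = z * (k + 1) := ⟨x / (k + 1), by field_simp⟩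
  rw [mul_div_cancel_right₀ _ hk1.ne']
  -- The arithmetic-geometric mean inequality trades the deviation for its square.
  have amgm : |z - ρ| ≤ ε / 2 * (z - ρ) ^ 2 + 1 / (2 * ε) := by
    have h : 0 ≤ (ε * |z - ρ| - 1) ^ 2 / (2 * ε) := by positivity
    have e : (ε * |z - ρ| - 1) ^ 2 / (2 * ε) =
        ε / 2 * |z - ρ| ^ 2 + 1 / (2 * ε) - |z - ρ| := by field_simp; ring
    rw [e, sq_abs] at h
    linarith
  unfold potential
  rw [mul_div_cancel_right₀ _ hk1.ne']
  rcases Nat.eq_zero_or_pos k with rfl | hk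
  · have : 0 ≤ ε / 2 := by positivity
    simp only [Nat.cast_zero, zero_add, Real.sqrt_one, Real.sqrt_zero, zero_mul, zero_div,
      mul_zero, add_zero, mul_add, one_mul, mul_one]
    linarith
  · have hk' : (1 : ℝ) ≤ k := by exact_mod_cast hk
    have hk0 : (0 : ℝ) < k := by linarith
    have hs := sqrt_add_inv_le hk'
    have e : z * (ε / 2 * (k * ((z * (k + 1) - 1) / k - ρ) ^ 2 + √k) + k / (2 * ε)) +
        (1 - z) * (ε / 2 * (k * (z * (k + 1) / k - ρ) ^ 2 + √k) + k / (2 * ε)) =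
        ε / 2 * (k * (z - ρ) ^ 2 + 4 * (z * (1 - z)) * (1 / (4 * k)) + √k) + k / (2 * ε) := by
      field_simp; ring
    have hv : 4 * (z * (1 - z)) * (1 / (4 * k)) ≤ 1 * (1 / (4 * (k : ℝ))) :=
      mul_le_mul_of_nonneg_right (by nlinarith [sq_nonneg (2 * z - 1)]) (by positivity)
    have : ε / 2 * (k * (z - ρ) ^ 2 + 4 * (z * (1 - z)) * (1 / (4 * k)) + √k) ≤
        ε / 2 * (k * (z - ρ) ^ 2 + √(k + 1)) :=
      mul_le_mul_of_nonneg_left (by linarith) (by positivity)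
    rw [e, add_div]
    linarith

/-- Adaptive sampling: over an exchangeable family in which every member has `x` indices of class
`c`, the nodes labelled `r` meet class `c` with frequency close to `ρ`, no matter how the tree
chooses its indices and labels. -/
theorem ClassTree.abs_sum_hits_sub_le {Ω : Type*} (κ : Ω → ℕ → Cls) (c : Cls) (r : Pivot)
    (ρ : ℝ) {ε : ℝ} (hε : 0 < ε) (T : ClassTree) :
    ∀ (A : Finset ℕ) (S : Finset Ω) (x : ℝ), T.Exhausts A → Exchangeable κ A S →
      (∀ ω ∈ S, (#{j ∈ A | κ ω j = c} : ℝ) = x) →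
      |∑ ω ∈ S, ((T.hits c r (κ ω) : ℝ) - ρ * T.visits r (κ ω))| ≤
        #S * potential ε ρ #A x := by
  induction T with
  | leaf =>
    intro A S x hT _ _
    rw [ClassTree.Exhausts] at hT
    simp [hits, visits, hT, potential]
  | node i l child ih =>
    intro A S x hT hS hx
    obtain ⟨hi, hc⟩ := hT
    have hcard : #A = #(A.erase i) + 1 := (card_erase_add_one hi).symm
    set k := #(A.erase i)
    have hfreq := hS.card_mul_card_filter hx hi
    rw [hcard] at hfreq
    push_cast at hfreq
    have hk1 : (0 : ℝ) < k + 1 := by positivity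
    have hfreq' : (#{ω ∈ S | κ ω i = c} : ℝ) = x / (k + 1) * #S := by
      field_simp; linarith
    let D (ω : Ω) : ℝ := ((child (κ ω i)).hits c r (κ ω) : ℝ) - ρ * (child (κ ω i)).visits r (κ ω)
    -- The number of indices of class `c` that remain after index `i` was found to have class `d`.
    have hrem : ∀ d, ∀ ω ∈ ({ω ∈ S | κ ω i = d} : Finset Ω),
        (#{j ∈ A.erase i | κ ω j = c} : ℝ) = if d = c then x - 1 else x := by
      intro d ω hω
      obtain ⟨hω, hd⟩ := mem_filter.1 hω
      rw [← hx ω hω, filter_erase]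
      split_ifs with h
      · have hmem : i ∈ ({j ∈ A | κ ω j = c} : Finset ℕ) := mem_filter.2 ⟨hi, hd.trans h⟩
        rw [← card_erase_add_one hmem]
        push_cast
        ring
      · rw [erase_eq_of_notMem]
        simp [hd, h]
    have hbranch : ∀ d, |∑ ω ∈ S with κ ω i = d, D ω| ≤
        #{ω ∈ S | κ ω i = d} * potential ε ρ k (if d = c then x - 1 else x) := by
      intro d
      have := ih d (A.erase i) {ω ∈ S | κ ω i = d} _ (hc d) (hS.filter_erase i d) (hrem d)
      convert this using 2
      refine sum_congr rfl fun ω hω => ?_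
      simp only [D, (mem_filter.1 hω).2]
    have hsplit : ∀ f : Ω → ℝ, ∑ ω ∈ S, f ω =
        (∑ ω ∈ S with κ ω i = .small, f ω) + (∑ ω ∈ S with κ ω i = .medium, f ω) +
          ∑ ω ∈ S with κ ω i = .large, f ω := by
      intro f
      simp only [sum_filter, ← sum_add_distrib]
      refine sum_congr rfl fun ω _ => ?_
      cases κ ω i <;> simp
    have hsplitc := hsplit fun _ => 1
    simp only [sum_const, nsmul_eq_mul, mul_one] at hsplitc
    have hsub : |∑ ω ∈ S, D ω| ≤ #S * (x / (k + 1) * potential ε ρ k (x - 1) +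
        (1 - x / (k + 1)) * potential ε ρ k x) := by
      rw [hsplit D]
      refine ((abs_add_le _ _).trans (add_le_add_left (abs_add_le _ _) _)).trans ?_
      refine (add_le_add (add_le_add (hbranch _) (hbranch _)) (hbranch _)).trans (le_of_eq ?_)
      have e : (#S : ℝ) * (x / (k + 1) * potential ε ρ k (x - 1) +
          (1 - x / (k + 1)) * potential ε ρ k x) =
          #{ω ∈ S | κ ω i = c} * potential ε ρ k (x - 1) +
          (#S - #{ω ∈ S | κ ω i = c}) * potential ε ρ k x := by
        rw [hfreq']; ring
      rw [e, hsplitc]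
      cases c <;> simp <;> ring
    have hhere : |∑ ω ∈ S, ((if l = r ∧ κ ω i = c then 1 else 0 : ℝ) - ρ * if l = r then 1 else 0)|
        ≤ #S * |x / (k + 1) - ρ| := by
      by_cases hl : l = r
      · simp only [hl, true_and, if_true, mul_one, sum_sub_distrib, sum_const, nsmul_eq_mul,
          ← sum_filter]
        rw [hfreq', show x / (k + 1) * (#S : ℝ) - #S * ρ = #S * (x / (k + 1) - ρ) by ring, abs_mul,
          Nat.abs_cast]
      · simp only [hl, false_and, if_false, mul_zero, sub_zero, sum_const_zero, abs_zero]
        positivity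
    have htot : ∑ ω ∈ S, (((ClassTree.node i l child).hits c r (κ ω) : ℝ) -
        ρ * (ClassTree.node i l child).visits r (κ ω)) =
        ∑ ω ∈ S, ((if l = r ∧ κ ω i = c then 1 else 0 : ℝ) - ρ * if l = r then 1 else 0) +
          ∑ ω ∈ S, D ω := by
      rw [← sum_add_distrib]
      refine sum_congr rfl fun ω _ => ?_
      simp only [hits, visits, D]
      push_cast
      ring
    rw [htot, hcard]
    push_cast
    calc _ ≤ _ := (abs_add_le _ _).trans (add_le_add hhere hsub)
      _ = #S * (|x / (k + 1) - ρ| + (x / (k + 1) * potential ε ρ k (x - 1) +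
          (1 - x / (k + 1)) * potential ε ρ k x)) := by ring
      _ ≤ _ := mul_le_mul_of_nonneg_left (abs_add_potential_le hε ρ k) (by positivity)

/-! ### The cost of a tree along a path -/

theorem ClassTree.pathCount_eq_visits (p q : ℕ) (a : ℕ → ℕ) (r : Pivot) (T : ClassTree) :
    T.pathCount p q a r = T.visits r fun i => classify p q (a i) := by
  induction T with
  | leaf => rfl
  | node i l child ih => rw [pathCount, visits, ih]

/-- Every element costs one comparison, a medium element a second one, and a small or large
element a second one exactly if it is first compared with the wrong pivot. -/
theorem ClassTree.pathComparisons_eq {p q : ℕ} (hpq : p < q) (a : ℕ → ℕ) (T : ClassTree) :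
    ∀ A : Finset ℕ, T.Exhausts A → (∀ i ∈ A, a i ≠ q) →
      T.pathComparisons p q a = #A + #{i ∈ A | classify p q (a i) = .medium} +
        T.hits .small .q (fun i => classify p q (a i)) +
        T.hits .large .p (fun i => classify p q (a i)) := by
  induction T with
  | leaf =>
    intro A hT _
    rw [ClassTree.Exhausts] at hT
    simp [pathComparisons, hits, hT]
  | node i l child ih =>
    intro A hT ha
    obtain ⟨hi, hc⟩ := hT
    have hq := ha i hi
    rw [pathComparisons, hits, hits,
      ih _ (A.erase i) (hc _) fun j hj => ha j (mem_of_mem_erase hj), ← card_erase_add_one hi]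
    have hmed : #{j ∈ A | classify p q (a j) = .medium} =
        #{j ∈ A.erase i | classify p q (a j) = .medium} +
          if classify p q (a i) = .medium then 1 else 0 := by
      conv_lhs => rw [← insert_erase hi, filter_insert]
      split_ifs
      · rw [card_insert_of_notMem (by simp)]
      · rfl
    rw [hmed]
    have hcmp : comparisons p q l (a i) = 1 + (if classify p q (a i) = .medium then 1 else 0) +
        (if l = .q ∧ classify p q (a i) = .small then 1 else 0) +
        (if l = .p ∧ classify p q (a i) = .large then 1 else 0) := by
      unfold comparisons classify
      cases l <;> simp only [reduceCtorEq, false_and, true_and, if_false] <;>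
        split_ifs <;> first | omega | simp_all
    omega

/-! ### Inputs with given numbers of small and large elements -/

/-- The inputs with exactly `s` small and `l` large elements. -/
def fiber (n s l : ℕ) : Finset (Input n) := {π | π.numSmall = s ∧ π.numLarge = l}

section Input

variable {n : ℕ} (π : Input n)

theorem Input.elt_mem_Icc {i : ℕ} (hi : i ∈ Icc 1 n) : π.elt i ∈ Icc 1 n := by
  rw [mem_Icc] at hi ⊢
  rw [Input.elt, dif_pos (by omega)]
  omega

theorem Input.elt_injOn : Set.InjOn π.elt (Icc 1 n : Finset ℕ) := by
  intro i hi j hj h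
  rw [mem_coe, mem_Icc] at hi hj
  rw [Input.elt, Input.elt, dif_pos (by omega), dif_pos (by omega), Nat.add_right_cancel_iff,
    Fin.val_inj, π.apply_eq_iff_eq, Fin.mk.injEq] at h
  omega

theorem Input.image_elt : (Icc 1 n).image π.elt = Icc 1 n :=
  eq_of_subset_of_card_le (image_subset_iff.2 fun _ => π.elt_mem_Icc)
    (card_image_of_injOn π.elt_injOn).ge

theorem Input.elt_mul_swap {i j : ℕ} (hi : i ∈ Icc 2 (n - 1)) (hj : j ∈ Icc 2 (n - 1)) :
    ∃ τ : Input n, ∀ (π : Input n) k, Input.elt (π * τ) k = π.elt (Equiv.swap i j k) := by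
  rw [mem_Icc] at hi hj
  refine ⟨Equiv.swap ⟨i - 1, by omega⟩ ⟨j - 1, by omega⟩, fun π k => ?_⟩
  rw [Equiv.swap_apply_def]
  unfold Input.elt
  simp only [Equiv.Perm.mul_apply, Equiv.swap_apply_def, Fin.mk.injEq]
  -- Index `0` reads the same entry as index `1`, and neither is moved.
  have e1 : k - 1 = i - 1 ↔ k = i := by omega
  have e2 : k - 1 = j - 1 ↔ k = j := by omega
  simp only [e1, e2]
  by_cases h1 : k = i
  · subst h1
    simp only [if_true]
    rw [dif_pos (by omega), dif_pos (by omega)]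
  · by_cases h2 : k = j
    · subst h2
      simp only [h1, if_true, if_false]
      rw [dif_pos (by omega), dif_pos (by omega)]
    · simp only [h1, h2, if_false]

variable {π}

theorem mem_fiber_iff {s l : ℕ} (hsl : s + l + 2 ≤ n) :
    π ∈ fiber n s l ↔ π.smallerPivot = s + 1 ∧ π.largerPivot = n - l := by
  have h1 := mem_Icc.1 (π.elt_mem_Icc (i := 1) (by rw [mem_Icc]; omega))
  have h2 := mem_Icc.1 (π.elt_mem_Icc (i := n) (by rw [mem_Icc]; omega))
  rw [fiber, mem_filter_univ]
  simp only [Input.numSmall, Input.numLarge, Input.smallerPivot, Input.largerPivot]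
  omega

theorem exchangeable_fiber {s l : ℕ} (hsl : s + l + 2 ≤ n) :
    Exchangeable (fun (π : Input n) i => classify (s + 1) (n - l) (π.elt i)) (Icc 2 (n - 1))
      (fiber n s l) := by
  intro i hi j hj
  obtain ⟨τ, hτ⟩ := Input.elt_mul_swap hi hj
  rw [mem_Icc] at hi hj
  refine ⟨(· * τ), fun π hπ => ?_, fun _ _ _ _ h => mul_right_cancel h, fun π _ k => ?_⟩
  · rw [mem_fiber_iff hsl] at hπ ⊢
    simp only [Input.smallerPivot, Input.largerPivot, hτ] at hπ ⊢
    rwa [Equiv.swap_apply_of_ne_of_ne (by omega) (by omega),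
      Equiv.swap_apply_of_ne_of_ne (by omega) (by omega)]
  · simp only [hτ]

theorem elt_ne_pivot {s l : ℕ} (hsl : s + l + 2 ≤ n) (hπ : π ∈ fiber n s l) {i : ℕ}
    (hi : i ∈ Icc 2 (n - 1)) : π.elt i ≠ s + 1 ∧ π.elt i ≠ n - l := by
  rw [mem_fiber_iff hsl, Input.smallerPivot, Input.largerPivot] at hπ
  rw [mem_Icc] at hi
  have h1 : π.elt i ≠ π.elt 1 := fun h => by
    have := π.elt_injOn (by simp; omega) (by simp; omega) h
    omega
  have h2 : π.elt i ≠ π.elt n := fun h => by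
    have := π.elt_injOn (by simp; omega) (by simp; omega) h
    omega
  omega

theorem card_filter_classify {s l : ℕ} (hsl : s + l + 2 ≤ n) (hπ : π ∈ fiber n s l) (c : Cls) :
    #{i ∈ Icc 2 (n - 1) | classify (s + 1) (n - l) (π.elt i) = c} =
      match c with | .small => s | .medium => n - 2 - s - l | .large => l := by
  have hset : ({i ∈ Icc 2 (n - 1) | classify (s + 1) (n - l) (π.elt i) = c} : Finset ℕ) =
      {i ∈ Icc 1 n | π.elt i ≠ s + 1 ∧ π.elt i ≠ n - l ∧
        classify (s + 1) (n - l) (π.elt i) = c} := by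
    ext i
    simp only [mem_filter]
    constructor
    · rintro ⟨hi, h⟩
      exact ⟨Icc_subset_Icc (by omega) (by omega) hi, (elt_ne_pivot hsl hπ hi).1,
        (elt_ne_pivot hsl hπ hi).2, h⟩
    · rintro ⟨hi, h1, h2, h⟩
      refine ⟨?_, h⟩
      rw [mem_fiber_iff hsl, Input.smallerPivot, Input.largerPivot] at hπ
      have i1 : i ≠ 1 := by rintro rfl; omega
      have i2 : i ≠ n := by rintro rfl; omega
      rw [mem_Icc] at hi ⊢
      omega
  rw [hset, ← card_image_of_injOn (π.elt_injOn.mono fun i hi => (mem_filter.1 hi).1),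
    ← filter_image (p := fun x => x ≠ s + 1 ∧ x ≠ n - l ∧ classify (s + 1) (n - l) x = c),
    Input.image_elt]
  have hIcc : ∀ a b, (∀ x, (1 ≤ x ∧ x ≤ n) ∧ x ≠ s + 1 ∧ x ≠ n - l ∧
      classify (s + 1) (n - l) x = c ↔ a ≤ x ∧ x ≤ b) →
      #{x ∈ Icc 1 n | x ≠ s + 1 ∧ x ≠ n - l ∧ classify (s + 1) (n - l) x = c} = b + 1 - a := by
    intro a b h
    rw [← Nat.card_Icc]
    congr 1
    ext x
    simpa only [mem_filter, mem_Icc] using h x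
  cases c
  · rw [hIcc 1 s]
    · rfl
    · intro x
      unfold classify
      split_ifs <;> simp <;> omega
  · rw [hIcc (s + 2) (n - l - 1)]
    · simp only; omega
    · intro x
      unfold classify
      split_ifs <;> simp <;> omega
  · rw [hIcc (n - l + 1) n]
    · simp only; omega
    · intro x
      unfold classify
      split_ifs <;> simp <;> omega

/-- Relabelling the values by a permutation that carries one pair of pivots to another maps one
fibre into the other. -/
theorem card_fiber_le {s l s' l' : ℕ} (h : s + l + 2 ≤ n) (h' : s' + l' + 2 ≤ n) :
    #(fiber n s l) ≤ #(fiber n s' l') := by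
  let x : Fin n := ⟨s, by omega⟩
  let y : Fin n := ⟨n - l - 1, by omega⟩
  let x' : Fin n := ⟨s', by omega⟩
  let y' : Fin n := ⟨n - l' - 1, by omega⟩
  have hxy : x ≠ y := by simp only [x, y, ne_eq, Fin.mk.injEq]; omega
  have hxy' : x' ≠ y' := by simp only [x', y', ne_eq, Fin.mk.injEq]; omega
  obtain ⟨τ, hx, hy⟩ : ∃ τ : Equiv.Perm (Fin n), τ x = x' ∧ τ y = y' := by
    refine ⟨Equiv.swap (Equiv.swap x x' y) y' * Equiv.swap x x', ?_, ?_⟩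
    · rw [Equiv.Perm.mul_apply, Equiv.swap_apply_left, Equiv.swap_apply_of_ne_of_ne _ hxy']
      intro e
      apply hxy
      rw [← (Equiv.swap x x').apply_eq_iff_eq, ← e, Equiv.swap_apply_left]
    · rw [Equiv.Perm.mul_apply, Equiv.swap_apply_left]
  have hmem : ∀ (π : Input n) {s l : ℕ} (h : s + l + 2 ≤ n), π ∈ fiber n s l ↔
      (π ⟨0, by omega⟩ = ⟨s, by omega⟩ ∧ π ⟨n - 1, by omega⟩ = ⟨n - l - 1, by omega⟩) ∨
      (π ⟨n - 1, by omega⟩ = ⟨s, by omega⟩ ∧ π ⟨0, by omega⟩ = ⟨n - l - 1, by omega⟩) := by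
    intro π s l h
    have e1 : π.elt 1 = π ⟨0, by omega⟩ + 1 := by rw [Input.elt, dif_pos]
    have e2 : π.elt n = π ⟨n - 1, by omega⟩ + 1 := by rw [Input.elt, dif_pos]
    rw [mem_fiber_iff h, Input.smallerPivot, Input.largerPivot, e1, e2]
    simp only [Fin.ext_iff]
    omega
  refine card_le_card_of_injOn (τ * ·) (fun π hπ => ?_) fun _ _ _ _ e => mul_left_cancel e
  rw [mem_coe, hmem π h] at hπ
  rw [mem_coe, hmem _ h']
  simp only [Equiv.Perm.mul_apply]
  rcases hπ with ⟨h1, h2⟩ | ⟨h1, h2⟩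
  · exact Or.inl ⟨by rw [h1]; exact hx, by rw [h2]; exact hy⟩
  · exact Or.inr ⟨by rw [h1]; exact hx, by rw [h2]; exact hy⟩

theorem Input.numSmall_add_numLarge_add_two_le (hn : 2 ≤ n) (π : Input n) :
    π.numSmall + π.numLarge + 2 ≤ n := by
  have m1 : 1 ∈ Icc 1 n := by rw [mem_Icc]; omega
  have m2 : n ∈ Icc 1 n := by rw [mem_Icc]; omega
  have h1 := mem_Icc.1 (π.elt_mem_Icc m1)
  have h2 := mem_Icc.1 (π.elt_mem_Icc m2)
  have h3 : π.elt 1 ≠ π.elt n := fun h => by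
    have := π.elt_injOn m1 m2 h
    omega
  simp only [Input.numSmall, Input.numLarge, Input.smallerPivot, Input.largerPivot]
  omega

theorem sum_fiber (hn : 2 ≤ n) (f : Input n → ℝ) :
    ∑ s ∈ range (n - 1), ∑ l ∈ range (n - 1 - s), ∑ π ∈ fiber n s l, f π = ∑ π, f π := by
  rw [sum_sigma' _ _ fun s l => ∑ π ∈ fiber n s l, f π]
  have hmaps : ∀ π ∈ (univ : Finset (Input n)), (⟨π.numSmall, π.numLarge⟩ : (_ : ℕ) × ℕ) ∈
      (range (n - 1)).sigma fun s => range (n - 1 - s) := by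
    intro π _
    have := π.numSmall_add_numLarge_add_two_le hn
    simp only [mem_sigma, mem_range]
    omega
  rw [← sum_fiberwise_of_maps_to hmaps]
  refine sum_congr rfl fun x _ => sum_congr ?_ fun _ _ => rfl
  ext π
  rw [fiber, mem_filter_univ, mem_filter_univ, Sigma.ext_iff, heq_eq_eq]

end Input

/-! ### Sums over the triangle of all numbers of small and large elements -/

theorem sum_triangle_one (K : ℕ) :
    ∑ s ∈ range K, ∑ _l ∈ range (K - s), (1 : ℝ) = (K + 1).choose 2 := by
  induction K with
  | zero => simp
  | succ K ih =>
    rw [sum_range_succ']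
    simp only [Nat.add_sub_add_right, ih, Nat.choose_succ_succ' (K + 1) 1]
    simp [add_comm]

theorem sum_triangle_medium (K : ℕ) :
    ∑ s ∈ range K, ∑ l ∈ range (K - s), ((K : ℝ) - 1 - s - l) =
      (K + 1).choose 2 * ((K - 1) / 3) := by
  induction K with
  | zero => simp
  | succ K ih =>
    rw [sum_range_succ']
    have e : ∀ s ∈ range K, ∑ l ∈ range (K + 1 - (s + 1)),
        (((K + 1 : ℕ) : ℝ) - 1 - ((s + 1 : ℕ) : ℝ) - l) =
        ∑ l ∈ range (K - s), ((K : ℝ) - 1 - s - l) := by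
      intro s _
      rw [Nat.add_sub_add_right]
      refine sum_congr rfl fun l _ => ?_
      push_cast
      ring
    have g : ∑ l ∈ range (K + 1), (l : ℝ) = (K + 1) * K / 2 := by
      have := sum_range_id_mul_two (K + 1)
      rw [Nat.add_sub_cancel] at this
      rw [eq_div_iff two_ne_zero, ← Nat.cast_sum]
      exact_mod_cast this
    rw [sum_congr rfl e, ih, sum_sub_distrib, sum_const, card_range, Nat.sub_zero, g,
      Nat.cast_choose_two, Nat.cast_choose_two]
    simp only [nsmul_eq_mul]
    push_cast
    ring

theorem card_fiber_mul_choose {n s l : ℕ} (h : s + l + 2 ≤ n) :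
    (#(fiber n s l) : ℝ) * n.choose 2 = Fintype.card (Input n) := by
  have hsum := sum_fiber (n := n) (by omega) fun _ => 1
  have hconst : ∀ s' ∈ range (n - 1), ∑ l' ∈ range (n - 1 - s'), ∑ _π ∈ fiber n s' l', (1 : ℝ) =
      ∑ l' ∈ range (n - 1 - s'), #(fiber n s l) * (1 : ℝ) := by
    intro s' hs'
    refine sum_congr rfl fun l' hl' => ?_
    rw [mem_range] at hs' hl'
    rw [sum_const, nsmul_eq_mul,
      le_antisymm (card_fiber_le (by omega) h) (card_fiber_le h (by omega))]
  rw [sum_congr rfl hconst] at hsum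
  simp only [← mul_sum] at hsum
  rw [sum_triangle_one, show n - 1 + 1 = n by omega] at hsum
  rw [hsum]
  simp

/-! ### The expected cost -/

section Cost

variable {n s l : ℕ} (T : DecisionTree n)

/-- If `x` elements of each input with `s` small and `l` large elements have class `c`, then on
average over these inputs a fraction `x / (n - 2)` of the elements first compared with the pivot `r`
has class `c`, up to an error of `n ^ (3 / 4)` elements. -/
theorem abs_sum_hits_fiber_le (h : s + l + 2 ≤ n) (hn : 3 ≤ n) {c : Cls} {x : ℕ}
    (hx : ∀ π ∈ fiber n s l,
      #{i ∈ Icc 2 (n - 1) | classify (s + 1) (n - l) (π.elt i) = c} = x) (r : Pivot) :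
    |∑ π ∈ fiber n s l, ((T.tree.hits c r fun i => classify (s + 1) (n - l) (π.elt i) : ℝ) -
        x / ((n : ℝ) - 2) * T.firstCount r π)| ≤ #(fiber n s l) * (n : ℝ) ^ (3 / 4 : ℝ) := by
  have hn0 : (0 : ℝ) < n := by positivity
  have hn2 : (0 : ℝ) < n - 2 := by
    have : (3 : ℝ) ≤ n := by exact_mod_cast hn
    linarith
  have hcard : ((#(Icc 2 (n - 1)) : ℕ) : ℝ) = n - 2 := by
    rw [Nat.card_Icc, show n - 1 + 1 - 2 = n - 2 by omega, Nat.cast_sub (by omega)]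
    norm_num
  have hmain := T.tree.abs_sum_hits_sub_le
    (fun (π : Input n) i => classify (s + 1) (n - l) (π.elt i)) c r (x / ((n : ℝ) - 2))
    (ε := (n : ℝ) ^ (1 / 4 : ℝ)) (by positivity) (Icc 2 (n - 1)) (fiber n s l) x T.exhausts
    (exchangeable_fiber h) (fun π hπ => by exact_mod_cast hx π hπ)
  rw [hcard] at hmain
  have hpot : potential ((n : ℝ) ^ (1 / 4 : ℝ)) (x / ((n : ℝ) - 2)) (n - 2) x ≤
      (n : ℝ) ^ (3 / 4 : ℝ) := by
    have e1 : (n : ℝ) ^ (3 / 4 : ℝ) = (n : ℝ) ^ (1 / 4 : ℝ) * √n := by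
      rw [Real.sqrt_eq_rpow, ← Real.rpow_add hn0]; norm_num
    have e2 : (n : ℝ) ^ (3 / 4 : ℝ) = n / (n : ℝ) ^ (1 / 4 : ℝ) := by
      rw [eq_div_iff (by positivity), ← Real.rpow_add hn0]; norm_num
    have b1 : (n : ℝ) ^ (1 / 4 : ℝ) * √((n : ℝ) - 2) ≤ (n : ℝ) ^ (3 / 4 : ℝ) := by
      rw [e1]
      gcongr
      linarith
    have b2 : ((n : ℝ) - 2) / (n : ℝ) ^ (1 / 4 : ℝ) ≤ (n : ℝ) ^ (3 / 4 : ℝ) := by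
      rw [e2]
      gcongr
      linarith
    calc _ = ((n : ℝ) ^ (1 / 4 : ℝ) * √((n : ℝ) - 2) +
          ((n : ℝ) - 2) / (n : ℝ) ^ (1 / 4 : ℝ)) / 2 := by
            unfold potential; field_simp; ring
      _ ≤ _ := by linarith
  refine le_trans (le_of_eq ?_) (hmain.trans (mul_le_mul_of_nonneg_left hpot (by positivity)))
  congr 1
  refine sum_congr rfl fun π hπ => ?_
  rw [mem_fiber_iff h] at hπ
  rw [DecisionTree.firstCount, ClassTree.pathCount_eq_visits, hπ.1, hπ.2]

/-- Averaged over the inputs with `s` small and `l` large elements, the cost is `n - 1` for the first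
comparisons (including the one between the pivots), one more for each medium element, and one more
for each element first compared with the wrong pivot, whose mean number is replaced by its
approximation in terms of `condFirstCount`. -/
theorem abs_sum_cost_fiber_le (h : s + l + 2 ≤ n) (hn : 3 ≤ n) :
    |∑ π ∈ fiber n s l, (T.cost π : ℝ) - #(fiber n s l) * ((n - 1) + (n - 2 - s - l) +
      1 / ((n : ℝ) - 2) * (T.condFirstCount .q s l * s + T.condFirstCount .p s l * l))| ≤
      #(fiber n s l) * (2 * (n : ℝ) ^ (3 / 4 : ℝ)) := by
  have hF : (#(fiber n s l) : ℝ) ≠ 0 := by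
    intro h0
    have := card_fiber_mul_choose h
    rw [h0, zero_mul] at this
    exact Fintype.card_ne_zero (α := Input n) (by exact_mod_cast this.symm)
  have hcond : ∀ r, ∑ π ∈ fiber n s l, (T.firstCount r π : ℝ) =
      #(fiber n s l) * T.condFirstCount r s l := by
    intro r
    rw [DecisionTree.condFirstCount, expect_eq_sum_div_card]
    change _ = (#(fiber n s l) : ℝ) * ((∑ π ∈ fiber n s l, _) / #(fiber n s l))
    field_simp
  have hs := abs_sum_hits_fiber_le T h hn (fun π hπ => card_filter_classify h hπ .small) .q
  have hl := abs_sum_hits_fiber_le T h hn (fun π hπ => card_filter_classify h hπ .large) .p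
  rw [sum_sub_distrib, ← mul_sum, hcond] at hs hl
  have hcost : ∑ π ∈ fiber n s l, (T.cost π : ℝ) =
      #(fiber n s l) * (((n : ℝ) - 1) + (n - 2 - s - l)) +
      ∑ π ∈ fiber n s l, (T.tree.hits .small .q fun i =>
        classify (s + 1) (n - l) (π.elt i) : ℝ) +
      ∑ π ∈ fiber n s l, (T.tree.hits .large .p fun i =>
        classify (s + 1) (n - l) (π.elt i) : ℝ) := by
    rw [← nsmul_eq_mul, ← sum_const, ← sum_add_distrib, ← sum_add_distrib]
    refine sum_congr rfl fun π hπ => ?_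
    have hp := (mem_fiber_iff h).1 hπ
    have hmed := card_filter_classify h hπ .medium
    rw [DecisionTree.cost, hp.1, hp.2, ClassTree.pathComparisons_eq (by omega) _ _ _ T.exhausts
      (fun i hi => (elt_ne_pivot h hπ hi).2), hmed, Nat.card_Icc]
    obtain ⟨m, rfl⟩ := Nat.exists_eq_add_of_le h
    rw [show s + l + 2 + m - 1 + 1 - 2 = s + l + m by omega,
      show s + l + 2 + m - 2 - s - l = m by omega]
    push_cast
    ring
  rw [hcost]
  refine le_trans (le_of_eq ?_) ((abs_add_le _ _).trans ((add_le_add hs hl).trans_eq (by ring)))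
  congr 1
  ring

end Cost

end DualPivot

theorem mainTheorem4 :
    ∃ err : ℕ → ℝ, err =o[Filter.atTop] (fun n : ℕ => (n : ℝ)) ∧
      ∀ n : ℕ, 3 ≤ n → ∀ T : DualPivot.DecisionTree n,
        |T.expectedCost -
            (4 / 3 * (n : ℝ) +
              1 / ((n.choose 2 : ℝ) * ((n : ℝ) - 2)) *
                ∑ s ∈ Finset.range (n - 1), ∑ l ∈ Finset.range (n - 1 - s),
                  (T.condFirstCount .q s l * (s : ℝ) + T.condFirstCount .p s l * (l : ℝ)))|
          ≤ err n := by
  refine ⟨fun n => 2 * (n : ℝ) ^ (3 / 4 : ℝ) + 5 / 3, ?_, fun n hn T => ?_⟩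
  · have h1 : (fun x : ℝ => x ^ (3 / 4 : ℝ)) =o[Filter.atTop] fun x : ℝ => x := by
      refine Asymptotics.isLittleO_of_tendsto' ?_ ?_
      · filter_upwards [Filter.eventually_gt_atTop 0] with x hx h0
        exact absurd h0 hx.ne'
      · refine (tendsto_rpow_neg_atTop (show (0 : ℝ) < 1 / 4 by norm_num)).congr' ?_
        filter_upwards [Filter.eventually_gt_atTop 0] with x hx
        rw [eq_div_iff hx.ne', ← Real.rpow_add_one hx.ne']
        norm_num
    exact ((h1.const_mul_left 2).add (Asymptotics.isLittleO_const_id_atTop (5 / 3))).comp_tendsto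
      tendsto_natCast_atTop_atTop
  · set C : ℝ := (n.choose 2 : ℝ)
    have hC : 0 < C := Nat.cast_pos.2 (Nat.choose_pos (by omega))
    have hn3 : (3 : ℝ) ≤ n := by exact_mod_cast hn
    have hn2 : (n : ℝ) - 2 ≠ 0 := by linarith
    have hM : (0 : ℝ) < Fintype.card (DualPivot.Input n) :=
      Nat.cast_pos.2 Fintype.card_pos
    set M : ℝ := (Fintype.card (DualPivot.Input n) : ℝ)
    let R (s l : ℕ) : ℝ := T.condFirstCount .q s l * s + T.condFirstCount .p s l * l
    have hK : ((n - 1 : ℕ) : ℝ) = n - 1 := by rw [Nat.cast_sub (by omega), Nat.cast_one]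
    have hone := DualPivot.sum_triangle_one (n - 1)
    have hmed := DualPivot.sum_triangle_medium (n - 1)
    rw [show n - 1 + 1 = n by omega] at hone hmed
    rw [hK] at hmed
    change _ = C at hone
    -- The terms that do not depend on the tree contribute `(n - 1) + (n - 2) / 3`.
    have hmain : ∑ s ∈ Finset.range (n - 1), ∑ l ∈ Finset.range (n - 1 - s),
        M / C * (((n : ℝ) - 1) + (n - 2 - s - l) + 1 / ((n : ℝ) - 2) * R s l) =
        M * (((n : ℝ) - 1) + (n - 2) / 3 + 1 / (C * ((n : ℝ) - 2)) *
          ∑ s ∈ Finset.range (n - 1), ∑ l ∈ Finset.range (n - 1 - s), R s l) := by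
      have e : ∀ s l : ℕ,
          M / C * (((n : ℝ) - 1) + (n - 2 - s - l) + 1 / ((n : ℝ) - 2) * R s l) =
          M / C * (n - 1) * 1 + M / C * (n - 1 - 1 - s - l) + M / C * (1 / (n - 2)) * R s l := by
        intro s l; ring
      simp only [e, Finset.sum_add_distrib, ← Finset.mul_sum]
      rw [hone, hmed]
      field_simp
      ring
    have hbound : |∑ π, (T.cost π : ℝ) - M * (((n : ℝ) - 1) + (n - 2) / 3 +
        1 / (C * ((n : ℝ) - 2)) *
          ∑ s ∈ Finset.range (n - 1), ∑ l ∈ Finset.range (n - 1 - s), R s l)| ≤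
        M * (2 * (n : ℝ) ^ (3 / 4 : ℝ)) := by
      rw [← hmain, ← DualPivot.sum_fiber (by omega)]
      simp only [← Finset.sum_sub_distrib]
      calc _ ≤ ∑ s ∈ Finset.range (n - 1), ∑ l ∈ Finset.range (n - 1 - s),
            M / C * (2 * (n : ℝ) ^ (3 / 4 : ℝ)) * 1 := by
            refine (Finset.abs_sum_le_sum_abs _ _).trans (Finset.sum_le_sum fun s hs =>
              (Finset.abs_sum_le_sum_abs _ _).trans (Finset.sum_le_sum fun l hl => ?_))
            rw [Finset.mem_range] at hs hl
            have h : s + l + 2 ≤ n := by omega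
            rw [← eq_div_of_mul_eq hC.ne' (DualPivot.card_fiber_mul_choose h), mul_one]
            exact DualPivot.abs_sum_cost_fiber_le T h hn
        _ = _ := by
            simp only [← Finset.mul_sum]
            rw [hone]
            field_simp
    have hE : T.expectedCost = (∑ π, (T.cost π : ℝ)) / M :=
      Fintype.expect_eq_sum_div_card _
    set Q := 1 / (C * ((n : ℝ) - 2)) *
      ∑ s ∈ Finset.range (n - 1), ∑ l ∈ Finset.range (n - 1 - s), R s l
    have h1 : |T.expectedCost - (((n : ℝ) - 1) + (n - 2) / 3 + Q)| ≤
        2 * (n : ℝ) ^ (3 / 4 : ℝ) := by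
      rw [hE, ← mul_le_mul_iff_right₀ hM, ← abs_of_pos hM, ← abs_mul, abs_of_pos hM, mul_sub,
        mul_div_cancel₀ _ hM.ne']
      exact hbound
    rw [abs_le] at h1 ⊢
    constructor <;> linarith [h1.1, h1.2]
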